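/- Let $\mathcal G$ be a compact, finite, connected metric graph with finite vertex set $V$, finite edge set $E$ and edge lengths $\ell_e>0$, without multiple edges and with at most one loop at each vertex. Each edge $e$ is identified with $[0,\ell_e]$, and a function on $\mathcal G$ is a family $u=(u_e)_{e\in E}$ of functions on these intervals; $\int_{\mathcal G}u\,dx:=\sum_{e\in E}\int_0^{\ell_e}u_e(t)\,dt$. Write $y\sim x$ if some edge joins $y$ and $x$ (a loop if $y=x$), and then $\ell_{yx}$ for its length. The degree of a vertex is the number of edges incident in it. Let $V_D$ be the set of vertices of degree $1$, assume that $V_D\neq\emptyset$, and let $V_N:=V\setminus V_D$. Let $H$ be the space of all $u$ such that $u_e\in H^1(0,\ell_e)$ for every $e\in E$, $u$ is continuous at the vertices, and $u=0$ on $V_D$. Let $\Delta_{\mathcal G}$ be the Laplacian on $L^2(\mathcal G)$ associated with the quadratic form $a_{\mathcal G}(u)=\int_{\mathcal G}|u'|^2dx$ on $H$ (Dirichlet conditions on $V_D$, Kirchhoff conditions on $V_N$). Then there is exactly one torsion function $v$ of $\mathcal G$, that is, a solution of $-\Delta_{\mathcal G}v=1$: a function $v\in H$ with $\int_{\mathcal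 G}v'\varphi'\,dx=\int_{\mathcal G}\varphi\,dx$ for all $\varphi\in H$. The quantum torsional rigidity of $\mathcal G$ is $T_q(\mathcal G):=\int_{\mathcal G}|v|\,dx$. Let $c>0$ be such that $$\widetilde w_{xx}:=\sum_{y\sim x}c\,\ell_{yx}-\sum_{y\sim x}\frac1{c\,\ell_{yx}}>0\qquad\text{for all }x\in V_N$$ (a loop at $x$ contributes the term $y=x$ to both sums), and put $\widetilde w_{xx}:=0$ for $x\in V_D$. Let $G_c$ be the weighted discrete graph on $V$ with the symmetric weights $$w_{yx}=\frac1{c\,\ell_{yx}}\ \text{ if } y\sim x,\ y\ne x;\qquad w_{yx}=0\ \text{ if } y\not\sim x,\ y\neq x;$$ $$w_{xx}=\frac1{c\,\ell_{xx}}+c\,\ell_{xx}+\widetilde w_{xx}\ \text{ if there is a loop at }x;\qquad w_{xx}=\widetilde w_{xx}\ \text{ otherwise}.$$ Let $d_x:=\sum_{y\in V}w_{xy}$, $m^{G_c}_x:=\frac1{d_x}\sum_{y\in V}w_{xy}\delta_y$, $\nu_{G_c}(A):=\sum_{x\in A}d_x$, and let $\partial_{m^{G_c}}V_N:=\{x\in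 V\setminus V_N: m^{G_c}_x(V_N)>0\}$. Then there is exactly one function $f$ on $V_N\cup\partial_{m^{G_c}}V_N$ (the $m^{G_c}$-stress function of $V_N$) with $$-\int_{V_N\cup\partial_{m^{G_c}}V_N}\bigl(f(y)-f(x)\bigr)\,dm^{G_c}_x(y)=1\ \text{ for } x\in V_N,\qquad f=0\ \text{ on }\partial_{m^{G_c}}V_N .$$ Set $T_{m^{G_c}}(V_N):=\int_{V_N}f\,d\nu_{G_c}$. Then, for every such $c$, $$T_q(\mathcal G)=\frac1{12}\sum_{e\in E}\ell_e^3+\frac1{4c^3}\,T_{m^{G_c}}(V_N).$$ -/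

import Mathlib

open MeasureTheory ProbabilityTheory Set
open scoped ENNReal

/-! ### Random walks, stress functions and torsional rigidity -/

section RandomWalk

variable {X : Type*} [MeasurableSpace X]

/-- The `m`-boundary of `Ω`: the points outside `Ω` from which the walk can jump into `Ω`. -/
def mBoundary (m : Kernel X X) (Ω : Set X) : Set X :=
  {x | x ∉ Ω ∧ 0 < m x Ω}

/-- The `m`-closure of `Ω`. -/
def mClosure (m : Kernel X X) (Ω : Set X) : Set X :=
  Ω ∪ mBoundary m Ω

/-- `f` is an `m`-stress function of `Ω`: an `L²(Ω_m, ν)` solution of `-Δ_m f = 1` in `Ω`,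
`f = 0` on the `m`-boundary of `Ω`, that is, `-∫_{Ω_m} (f y - f x) dm_x(y) = 1` for `x ∈ Ω`. -/
structure IsStressFunction (m : Kernel X X) (ν : Measure X) (Ω : Set X) (f : X → ℝ) : Prop where
  memLp : MemLp f 2 (ν.restrict (mClosure m Ω))
  integrableOn : ∀ x ∈ Ω, IntegrableOn f (mClosure m Ω) (m x)
  equation : ∀ x ∈ Ω, -∫ y in mClosure m Ω, (f y - f x) ∂(m x) = 1
  boundary : ∀ x ∈ mBoundary m Ω, f x = 0

open Classical in
/-- The `m`-torsional rigidity `T_m(Ω) = ∫_Ω f dν`, where `f` is the `m`-stress function of `Ω`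
(and `0` by convention if there is none). -/
noncomputable def torsionalRigidity (m : Kernel X X) (ν : Measure X) (Ω : Set X) : ℝ :=
  if h : ∃ f, IsStressFunction m ν Ω f then ∫ x in Ω, h.choose x ∂ν else 0

end RandomWalk

/-! ### Finite weighted discrete graphs as random walk spaces -/

/-- A finite weighted graph on `V`, possibly with loops: `x ∼ y` if and only if `weight x y` is
positive. Every vertex has positive total weight. -/
structure WeightedGraph (V : Type*) [Fintype V] where
  weight : V → V → ℝ
  symm : ∀ x y, weight x y = weight y x
  nonneg : ∀ x y, 0 ≤ weight x y
  sum_pos : ∀ x, 0 < ∑ y, weight x y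

namespace WeightedGraph

variable {V : Type*} [Fintype V]

/-- The weight `d_x = ∑_y w_{xy}` at the vertex `x`. -/
noncomputable def vertexWeight (G : WeightedGraph V) (x : V) : ℝ :=
  ∑ y, G.weight x y

variable [MeasurableSpace V] [DiscreteMeasurableSpace V]

/-- The random walk `m_x = (1 / d_x) ∑_y w_{xy} δ_y`. -/
noncomputable def randomWalk (G : WeightedGraph V) : Kernel V V where
  toFun x := ∑ y, ENNReal.ofReal (G.weight x y / G.vertexWeight x) • Measure.dirac y
  measurable' := measurable_of_countable _

instance (G : WeightedGraph V) : IsMarkovKernel G.randomWalk where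
  isProbabilityMeasure x := by
    constructor
    change (∑ y, ENNReal.ofReal (G.weight x y / G.vertexWeight x) • Measure.dirac y) univ = 1
    have hd : 0 < G.vertexWeight x := G.sum_pos x
    simp only [Measure.finsetSum_apply, Measure.smul_apply, measure_univ, smul_eq_mul, mul_one]
    rw [← ENNReal.ofReal_sum_of_nonneg fun y _ => div_nonneg (G.nonneg x y) hd.le,
      ← Finset.sum_div]
    change ENNReal.ofReal (G.vertexWeight x / G.vertexWeight x) = 1
    rw [div_self hd.ne', ENNReal.ofReal_one]

/-- The reversible measure `ν_G(A) = ∑_{x ∈ A} d_x`. -/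
noncomputable def measure (G : WeightedGraph V) : Measure V :=
  ∑ x, ENNReal.ofReal (G.vertexWeight x) • Measure.dirac x

end WeightedGraph

/-! ### Compact finite metric graphs -/

/-- A finite metric graph with vertex set `V` and edge set `E`, without multiple edges and with at
most one loop at each vertex. The edge `e` is identified with `[0, length e]`, the coordinate `0`
being the vertex `src e` and the coordinate `length e` being the vertex `tgt e`. -/
structure MetricGraph (V E : Type*) where
  src : E → V
  tgt : E → V
  length : E → ℝ
  length_pos : ∀ e, 0 < length e
  simple : Function.Injective fun e => s(src e, tgt e)

namespace MetricGraph

variable {V E : Type*}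

/-- `x ∼ y`: some edge joins `x` and `y` (a loop if `x = y`). -/
def Adj (G : MetricGraph V E) (x y : V) : Prop :=
  ∃ e, s(G.src e, G.tgt e) = s(x, y)

theorem Adj.symm {G : MetricGraph V E} {x y : V} (h : G.Adj x y) : G.Adj y x := by
  obtain ⟨e, he⟩ := h
  exact ⟨e, he.trans Sym2.eq_swap⟩

/-- Any two vertices are joined by a path. -/
def Connected (G : MetricGraph V E) : Prop :=
  ∀ x y, Relation.ReflTransGen G.Adj x y

/-- The number of edges incident in `x`. -/
noncomputable def degree (G : MetricGraph V E) (x : V) : ℕ :=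
  {e | G.src e = x ∨ G.tgt e = x}.ncard

/-- The Dirichlet vertices `V_D`. -/
def dirichletVertices (G : MetricGraph V E) : Set V :=
  {x | G.degree x = 1}

/-- The remaining vertices `V_N = V \ V_D`. -/
def kirchhoffVertices (G : MetricGraph V E) : Set V :=
  G.dirichletVerticesᶜ

/-! A function on the graph is a family `u : E → ℝ → ℝ`, of which only the restrictions of `u e` to
`[0, length e]` matter. -/

/-- The form domain: `u` belongs to `H¹(0, ℓ_e)` (absolutely continuous with square integrable
derivative) on every edge `e`, the values at the ends of edges that meet at a vertex agree, and the
value at every Dirichlet vertex is `0`. -/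
structure MemFormDomain (G : MetricGraph V E) (u : E → ℝ → ℝ) : Prop where
  absolutelyContinuous : ∀ e, AbsolutelyContinuousOnInterval (u e) 0 (G.length e)
  memLp_deriv : ∀ e, MemLp (deriv (u e)) 2 (volume.restrict (Ioo 0 (G.length e)))
  vertex : ∃ val : V → ℝ,
    (∀ e, u e 0 = val (G.src e) ∧ u e (G.length e) = val (G.tgt e)) ∧
    ∀ x ∈ G.dirichletVertices, val x = 0

variable [Fintype E]

/-- The integral `∫_𝒢 u(x) dx`. -/
noncomputable def integral (G : MetricGraph V E) (u : E → ℝ → ℝ) : ℝ :=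
  ∑ e, ∫ t in (0 : ℝ)..G.length e, u e t

/-- The bilinear form `∫_𝒢 u'(x) φ'(x) dx`, whose quadratic form is `∫_𝒢 |u'(x)|² dx`. -/
noncomputable def form (G : MetricGraph V E) (u φ : E → ℝ → ℝ) : ℝ :=
  G.integral fun e t => deriv (u e) t * deriv (φ e) t

/-- `u` is in the domain of the Laplacian associated with the form, and `Δ_𝒢 u = g`, where
`g ∈ L²(𝒢)`: this is the Laplacian with Dirichlet conditions at `V_D` and Kirchhoff conditions at
`V_N`. -/
structure HasLaplacian (G : MetricGraph V E) (u g : E → ℝ → ℝ) : Prop where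
  mem : G.MemFormDomain u
  memLp : ∀ e, MemLp (g e) 2 (volume.restrict (Ioo 0 (G.length e)))
  eq : ∀ φ, G.MemFormDomain φ → -G.form u φ = G.integral fun e t => g e t * φ e t

/-- `v` is a torsion function of `𝒢`: `-Δ_𝒢 v = 1`, with `v = 0` on `V_D` (which is part of the form
domain). -/
def IsTorsionFunction (G : MetricGraph V E) (v : E → ℝ → ℝ) : Prop :=
  G.HasLaplacian v fun _ _ => -1

open Classical in
/-- The quantum torsional rigidity `T_q(𝒢) = ∫_𝒢 |v| dx`, where `v` is the torsion function
(and `0` by convention if there is none). -/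
noncomputable def quantumTorsionalRigidity (G : MetricGraph V E) : ℝ :=
  if h : ∃ v, G.IsTorsionFunction v then G.integral fun e t => |h.choose e t| else 0

open Classical in
/-- The length `ℓ_{x,y}` of the edge that joins `x` and `y`, and `0` if there is none
(the sum has at most one nonzero term). -/
noncomputable def lengthBetween (G : MetricGraph V E) (x y : V) : ℝ :=
  ∑ e, if s(G.src e, G.tgt e) = s(x, y) then G.length e else 0

theorem lengthBetween_comm (G : MetricGraph V E) (x y : V) :
    G.lengthBetween x y = G.lengthBetween y x := by
  unfold lengthBetween
  rw [Sym2.eq_swap]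

theorem lengthBetween_nonneg (G : MetricGraph V E) (x y : V) : 0 ≤ G.lengthBetween x y :=
  Finset.sum_nonneg fun e _ => by
    split_ifs
    exacts [(G.length_pos e).le, le_rfl]

theorem lengthBetween_pos {G : MetricGraph V E} {x y : V} (h : G.Adj x y) :
    0 < G.lengthBetween x y := by
  classical
  obtain ⟨e, he⟩ := h
  refine Finset.sum_pos' (fun e _ => ?_) ⟨e, Finset.mem_univ _, ?_⟩
  · split_ifs
    exacts [(G.length_pos e).le, le_rfl]
  · rw [if_pos he]
    exact G.length_pos e

variable [Fintype V]

open Classical in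
/-- `w̃_{xx} = ∑_{y ∼ x} c ℓ_{yx} - ∑_{y ∼ x} 1 / (c ℓ_{yx})`, where a loop at `x` contributes one
term, `y = x`, to each sum. -/
noncomputable def wTilde (G : MetricGraph V E) (c : ℝ) (x : V) : ℝ :=
  ∑ y with G.Adj y x, c * G.lengthBetween y x - ∑ y with G.Adj y x, 1 / (c * G.lengthBetween y x)

/-- The admissible values of `c`. -/
def Admissible (G : MetricGraph V E) (c : ℝ) : Prop :=
  0 < c ∧ ∀ x ∈ G.kirchhoffVertices, 0 < G.wTilde c x

open Classical in
/-- The weights of `G_c`. The quantity `w̃_{xx}` enters at the vertices of `V_N` only. -/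
noncomputable def discreteWeight (G : MetricGraph V E) (c : ℝ) (x y : V) : ℝ :=
  if x = y then
    (if G.Adj x x then 1 / (c * G.lengthBetween x x) + c * G.lengthBetween x x else 0) +
      (if x ∈ G.kirchhoffVertices then G.wTilde c x else 0)
  else if G.Adj x y then 1 / (c * G.lengthBetween x y) else 0

theorem discreteWeight_nonneg (G : MetricGraph V E) {c : ℝ} (hc : G.Admissible c) (x y : V) :
    0 ≤ G.discreteWeight c x y := by
  have h0 := hc.1.le
  have h1 := G.lengthBetween_nonneg
  have h2 := fun h => (hc.2 x h).le
  unfold discreteWeight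
  split_ifs with h3 h4 h5 h5 h4
  · exact add_nonneg (add_nonneg (one_div_nonneg.2 (mul_nonneg h0 (h1 _ _)))
      (mul_nonneg h0 (h1 _ _))) (h2 h5)
  · exact add_nonneg (add_nonneg (one_div_nonneg.2 (mul_nonneg h0 (h1 _ _)))
      (mul_nonneg h0 (h1 _ _))) le_rfl
  · exact add_nonneg le_rfl (h2 h5)
  · exact add_nonneg le_rfl le_rfl
  · exact one_div_nonneg.2 (mul_nonneg h0 (h1 _ _))
  · exact le_rfl

theorem exists_discreteWeight_pos (G : MetricGraph V E) {c : ℝ} (hc : G.Admissible c) (x : V) :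
    ∃ y, 0 < G.discreteWeight c x y := by
  have hpos : ∀ {x y}, G.Adj x y → 0 < c * G.lengthBetween x y :=
    fun h => mul_pos hc.1 (lengthBetween_pos h)
  by_cases hx : x ∈ G.kirchhoffVertices
  · refine ⟨x, ?_⟩
    have h2 := hc.2 x hx
    unfold discreteWeight
    rw [if_pos rfl, if_pos hx]
    split_ifs with h
    · have := hpos h
      positivity
    · simpa using h2
  · have hd : G.degree x = 1 := not_not.1 hx
    obtain ⟨e, he⟩ := Set.ncard_eq_one.1 hd
    have he : G.src e = x ∨ G.tgt e = x := by
      have : e ∈ {e | G.src e = x ∨ G.tgt e = x} := he ▸ rfl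
      exact this
    have hA : ∃ y, G.Adj x y := by
      rcases he with h | h
      · exact ⟨G.tgt e, e, by rw [h]⟩
      · exact ⟨G.src e, e, by rw [h]; exact Sym2.eq_swap⟩
    obtain ⟨y, hy⟩ := hA
    refine ⟨y, ?_⟩
    unfold discreteWeight
    by_cases hxy : x = y
    · subst hxy
      have := hpos hy
      rw [if_pos rfl, if_pos hy, if_neg hx]
      positivity
    · have := hpos hy
      rw [if_neg hxy, if_pos hy]
      positivity

/-- The weighted discrete graph `G_c` associated with the metric graph and an admissible `c`. -/
noncomputable def discreteGraph (G : MetricGraph V E) (c : ℝ) (hc : G.Admissible c) :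
    WeightedGraph V where
  weight := G.discreteWeight c
  symm x y := by
    by_cases h : x = y
    · rw [h]
    · have hA : G.Adj x y ↔ G.Adj y x := ⟨Adj.symm, Adj.symm⟩
      unfold discreteWeight
      rw [if_neg h, if_neg (Ne.symm h), G.lengthBetween_comm x y]
      by_cases h' : G.Adj x y
      · rw [if_pos h', if_pos (hA.1 h')]
      · rw [if_neg h', if_neg fun h2 => h' (hA.2 h2)]
  nonneg := G.discreteWeight_nonneg hc
  sum_pos x := by
    obtain ⟨y, hy⟩ := G.exists_discreteWeight_pos hc x
    exact Finset.sum_pos' (fun z _ => G.discreteWeight_nonneg hc x z) ⟨y, Finset.mem_univ _, hy⟩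

end MetricGraph

/-! ### Stress functions of finite weighted graphs -/

namespace WeightedGraph

variable {V : Type*} [Fintype V] [MeasurableSpace V] [DiscreteMeasurableSpace V]

/-! Both problems reduce to one Poisson equation on the vertices. On an edge of length `ℓ`, a
solution of `-u'' = 1` is the parabola `t(ℓ - t)/2` plus the affine interpolation of its end values,
so it is determined by its vertex values `a`. Let `L` be the vertex Laplacian with conductances
`1/ℓ` and `I x` the total length at `x`, loops counted twice. Integration by parts
(`form_torsionExtension`) turns the Kirchhoff condition into `L a = I/2` on `V_N`, with `a = 0` on
`V_D`. The parabolas integrate to `∑ ℓ³/12` and the affine parts to `½ ∑ a I`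
(`integral_torsionExtension`).

On the discrete side, `w_{xx}` drops out of the differences `f x - f y`, so the weights produce
`(1/c) L` (`sum_discreteWeight_mul_sub`). The choice of `w_{xx}` makes `d_x = c I x` on `V_N`
(`discreteGraph_vertexWeight`). The stress equation is therefore `L f = c² I`, so `f = 2c² a` and `∑
f d = 2c³ ∑ a I`; multiplied by `1/(4c³)`, this is the missing `½ ∑ a I`.

The Dirichlet problem for `L` is uniquely solvable because zero energy on a connected graph with a
Dirichlet vertex forces the zero function. The minimum principle gives `a ≥ 0`, which removes the
absolute value in the definition of the quantum torsional rigidity. -/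

theorem randomWalk_apply (G : WeightedGraph V) (x : V) :
    G.randomWalk x =
      ∑ y, ENNReal.ofReal (G.weight x y / G.vertexWeight x) • Measure.dirac y := rfl

theorem randomWalk_real_singleton (G : WeightedGraph V) (x y : V) :
    (G.randomWalk x).real {y} = G.weight x y / G.vertexWeight x := by
  classical
  have hd : 0 < G.vertexWeight x := G.sum_pos x
  rw [Measure.real, randomWalk_apply]
  simp only [Measure.finsetSum_apply, Measure.smul_apply, smul_eq_mul,
    Measure.dirac_apply, indicator_apply, mem_singleton_iff, Pi.one_apply, mul_ite, mul_one,
    mul_zero, Finset.sum_ite_eq', Finset.mem_univ, if_true]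
  exact ENNReal.toReal_ofReal (div_nonneg (G.nonneg x y) hd.le)

instance (G : WeightedGraph V) : IsFiniteMeasure G.measure := by
  constructor
  rw [measure]
  simp only [Measure.finsetSum_apply, Measure.smul_apply, measure_univ, smul_eq_mul, mul_one]
  exact ENNReal.sum_lt_top.2 fun x _ => ENNReal.ofReal_lt_top

theorem measure_real_singleton (G : WeightedGraph V) (x : V) :
    G.measure.real {x} = G.vertexWeight x := by
  classical
  have hd : 0 < G.vertexWeight x := G.sum_pos x
  rw [Measure.real, measure]
  simp only [Measure.finsetSum_apply, Measure.smul_apply, smul_eq_mul,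
    Measure.dirac_apply, indicator_apply, mem_singleton_iff, Pi.one_apply, mul_ite, mul_one,
    mul_zero, Finset.sum_ite_eq', Finset.mem_univ, if_true]
  exact ENNReal.toReal_ofReal hd.le

/-- Since the weights are symmetric, a jump out of `Ω` can be reversed. Hence a walk started in `Ω`
stays in the `m`-closure for one step, and integrals over the closure become sums over all of `V`.
-/
theorem mem_mBoundary_of_weight_pos (G : WeightedGraph V) {Ω : Set V} {x y : V} (hx : x ∈ Ω)
    (hy : y ∉ Ω) (hw : 0 < G.weight x y) : y ∈ mBoundary G.randomWalk Ω := by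
  refine ⟨hy, ?_⟩
  have hd : 0 < G.vertexWeight y := G.sum_pos y
  have h : 0 < (G.randomWalk y).real {x} := by
    rw [randomWalk_real_singleton, G.symm]
    exact div_pos hw hd
  exact (ENNReal.toReal_pos_iff.1 h).1.trans_le (measure_mono (singleton_subset_iff.2 hx))

/-- On a finite graph, the equation of the stress function is the Poisson equation of the weighted
graph Laplacian. -/
theorem isStressFunction_iff (G : WeightedGraph V) (Ω : Set V) (f : V → ℝ) :
    IsStressFunction G.randomWalk G.measure Ω f ↔
      (∀ x ∈ Ω, ∑ y, G.weight x y * (f x - f y) = G.vertexWeight x) ∧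
        ∀ x ∈ mBoundary G.randomWalk Ω, f x = 0 := by
  have key : ∀ x ∈ Ω, -∫ y in mClosure G.randomWalk Ω, (f y - f x) ∂(G.randomWalk x) =
      (∑ y, G.weight x y * (f x - f y)) / G.vertexWeight x := by
    intro x hx
    rw [← integral_indicator .of_discrete, integral_fintype .of_finite, Finset.sum_div,
      ← Finset.sum_neg_distrib]
    refine Finset.sum_congr rfl fun y _ => ?_
    rw [randomWalk_real_singleton, smul_eq_mul]
    by_cases hy : y ∈ mClosure G.randomWalk Ω
    · rw [indicator_of_mem hy]
      ring
    · have hw : G.weight x y = 0 := by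
        by_contra hw
        have hyΩ : y ∉ Ω := fun h => hy (Or.inl h)
        exact hy (Or.inr (G.mem_mBoundary_of_weight_pos hx hyΩ
          (lt_of_le_of_ne (G.nonneg x y) (Ne.symm hw))))
      simp [hw]
  have hd : ∀ x, G.vertexWeight x ≠ 0 := fun x => (G.sum_pos x).ne'
  constructor
  · intro h
    refine ⟨fun x hx => ?_, h.boundary⟩
    have := h.equation x hx
    rwa [key x hx, div_eq_one_iff_eq (hd x)] at this
  · rintro ⟨h, hb⟩
    refine ⟨.of_discrete, fun x _ => Integrable.of_finite, fun x hx => ?_, hb⟩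
    rw [key x hx, div_eq_one_iff_eq (hd x)]
    exact h x hx

theorem setIntegral_measure (G : WeightedGraph V) (Ω : Set V) (f : V → ℝ) :
    ∫ x in Ω, f x ∂G.measure = ∑ x, Ω.indicator f x * G.vertexWeight x := by
  rw [← integral_indicator .of_discrete, integral_fintype .of_finite]
  refine Finset.sum_congr rfl fun x _ => ?_
  rw [measure_real_singleton, smul_eq_mul, mul_comm]

/-- Cutting off a stress function outside `Ω` does not affect its equation. -/
theorem _root_.IsStressFunction.sum_indicator {G : WeightedGraph V} {Ω : Set V} {f : V → ℝ}
    (h : IsStressFunction G.randomWalk G.measure Ω f) {x : V} (hx : x ∈ Ω) :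
    ∑ y, G.weight x y * (Ω.indicator f x - Ω.indicator f y) = G.vertexWeight x := by
  rw [← ((G.isStressFunction_iff Ω f).1 h).1 x hx]
  refine Finset.sum_congr rfl fun y _ => ?_
  rw [indicator_of_mem hx]
  by_cases hy : y ∈ Ω
  · rw [indicator_of_mem hy]
  · rw [indicator_of_notMem hy]
    rcases (G.nonneg x y).eq_or_lt with hw | hw
    · simp [← hw]
    · rw [h.boundary y (G.mem_mBoundary_of_weight_pos hx hy hw)]

end WeightedGraph

/-! ### The Laplacian on the vertices of a metric graph -/

namespace MetricGraph

variable {V E : Type*}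

/-- The value `0` propagates along a path from a Dirichlet vertex. -/
theorem eq_zero_of_src_eq_tgt {G : MetricGraph V E} (hconn : G.Connected)
    (hD : G.dirichletVertices.Nonempty) {φ : V → ℝ} (h0 : ∀ x ∈ G.dirichletVertices, φ x = 0)
    (h : ∀ e, φ (G.src e) = φ (G.tgt e)) (x : V) : φ x = 0 := by
  obtain ⟨z, hz⟩ := hD
  rw [← h0 z hz]
  induction hconn z x with
  | refl => rfl
  | tail _ hab ih =>
    obtain ⟨e, he⟩ := hab
    have := h e
    rcases Sym2.eq_iff.1 he with ⟨h1, h2⟩ | ⟨h1, h2⟩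
    · rw [← ih, ← h1, ← h2, this]
    · rw [← ih, ← h1, ← h2, this]

variable [Fintype E]

open Classical in
/-- The Laplacian on functions on the vertices, where the edge `e` has conductance
`1 / length e`. -/
noncomputable def vertexLaplacian (G : MetricGraph V E) : (V → ℝ) →ₗ[ℝ] V → ℝ where
  toFun f x := ∑ e, (f (G.src e) - f (G.tgt e)) / G.length e *
    ((if G.src e = x then 1 else 0) - (if G.tgt e = x then 1 else 0))
  map_add' f g := by
    ext x
    simp only [Pi.add_apply, ← Finset.sum_add_distrib]
    exact Finset.sum_congr rfl fun e _ => by ring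
  map_smul' r f := by
    ext x
    simp only [Pi.smul_apply, smul_eq_mul, RingHom.id_apply, Finset.mul_sum]
    exact Finset.sum_congr rfl fun e _ => by ring

open Classical in
/-- The total length of the edges at a vertex, where loops count twice. -/
noncomputable def incidentLength (G : MetricGraph V E) (x : V) : ℝ :=
  ∑ e, G.length e * ((if G.src e = x then 1 else 0) + (if G.tgt e = x then 1 else 0))

theorem incidentLength_nonneg (G : MetricGraph V E) (x : V) : 0 ≤ G.incidentLength x :=
  Finset.sum_nonneg fun e _ => mul_nonneg (G.length_pos e).le <| by split_ifs <;> norm_num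

section Vertices

variable [Fintype V]

/-- Summation by parts: each edge collects the contributions of its two ends, and those of a loop
cancel. -/
theorem sum_mul_vertexLaplacian (G : MetricGraph V E) (φ f : V → ℝ) :
    ∑ x, φ x * G.vertexLaplacian f x =
      ∑ e, (f (G.src e) - f (G.tgt e)) * (φ (G.src e) - φ (G.tgt e)) / G.length e := by
  classical
  simp only [vertexLaplacian, LinearMap.coe_mk, AddHom.coe_mk, Finset.mul_sum]
  rw [Finset.sum_comm]
  refine Finset.sum_congr rfl fun e _ => ?_
  have : ∀ x, φ x * ((f (G.src e) - f (G.tgt e)) / G.length e *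
      ((if G.src e = x then 1 else 0) - (if G.tgt e = x then 1 else 0))) =
      (f (G.src e) - f (G.tgt e)) / G.length e * ((if G.src e = x then φ x else 0) -
        (if G.tgt e = x then φ x else 0)) := fun x => by split_ifs <;> ring
  simp only [this, ← Finset.mul_sum, Finset.sum_sub_distrib, Finset.sum_ite_eq, Finset.mem_univ,
    if_true]
  ring

theorem sum_mul_incidentLength (G : MetricGraph V E) (φ : V → ℝ) :
    ∑ x, φ x * G.incidentLength x = ∑ e, G.length e * (φ (G.src e) + φ (G.tgt e)) := by
  classical
  simp only [incidentLength, Finset.mul_sum]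
  rw [Finset.sum_comm]
  refine Finset.sum_congr rfl fun e _ => ?_
  have : ∀ x, φ x * (G.length e *
      ((if G.src e = x then 1 else 0) + (if G.tgt e = x then 1 else 0))) =
      G.length e * ((if G.src e = x then φ x else 0) +
        (if G.tgt e = x then φ x else 0)) := fun x => by split_ifs <;> ring
  simp only [this, ← Finset.mul_sum, Finset.sum_add_distrib, Finset.sum_ite_eq, Finset.mem_univ,
    if_true]

end Vertices

theorem eq_zero_of_energy_nonpos {G : MetricGraph V E} (hconn : G.Connected)
    (hD : G.dirichletVertices.Nonempty) {φ : V → ℝ} (h0 : ∀ x ∈ G.dirichletVertices, φ x = 0)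
    (h : ∑ e, (φ (G.src e) - φ (G.tgt e)) ^ 2 / G.length e ≤ 0) (x : V) : φ x = 0 := by
  have hnn : ∀ e ∈ Finset.univ, 0 ≤ (φ (G.src e) - φ (G.tgt e)) ^ 2 / G.length e :=
    fun e _ => div_nonneg (sq_nonneg _) (G.length_pos e).le
  have hz := (Finset.sum_eq_zero_iff_of_nonneg hnn).1 (le_antisymm h (Finset.sum_nonneg hnn))
  refine eq_zero_of_src_eq_tgt hconn hD h0 (fun e => ?_) x
  have := hz e (Finset.mem_univ e)
  rw [div_eq_zero_iff, or_iff_left (G.length_pos e).ne', sq_eq_zero_iff, sub_eq_zero] at this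
  exact this

variable [Fintype V]

theorem eq_zero_of_vertexLaplacian_eq_zero {G : MetricGraph V E} (hconn : G.Connected)
    (hD : G.dirichletVertices.Nonempty) {f : V → ℝ} (h0 : ∀ x ∈ G.dirichletVertices, f x = 0)
    (h : ∀ x ∈ G.kirchhoffVertices, G.vertexLaplacian f x = 0) (x : V) : f x = 0 := by
  refine eq_zero_of_energy_nonpos hconn hD h0 (le_of_eq ?_) x
  simp only [sq]
  rw [← sum_mul_vertexLaplacian]
  refine Finset.sum_eq_zero fun x _ => ?_
  by_cases hx : x ∈ G.dirichletVertices
  · rw [h0 x hx, zero_mul]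
  · rw [h x hx, mul_zero]

theorem eq_of_vertexLaplacian_eq {G : MetricGraph V E} (hconn : G.Connected)
    (hD : G.dirichletVertices.Nonempty) {f g : V → ℝ}
    (hf : ∀ x ∈ G.dirichletVertices, f x = 0) (hg : ∀ x ∈ G.dirichletVertices, g x = 0)
    (h : ∀ x ∈ G.kirchhoffVertices, G.vertexLaplacian f x = G.vertexLaplacian g x) : f = g := by
  ext x
  refine sub_eq_zero.1 (eq_zero_of_vertexLaplacian_eq_zero hconn hD (f := f - g)
    (fun x hx => by simp [hf x hx, hg x hx]) (fun x hx => ?_) x)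
  rw [map_sub, Pi.sub_apply, h x hx, sub_self]

/-- The Poisson equation on the vertices, with Dirichlet conditions, is solvable. -/
theorem exists_vertexLaplacian_eq {G : MetricGraph V E} (hconn : G.Connected)
    (hD : G.dirichletVertices.Nonempty) (g : V → ℝ) :
    ∃ f : V → ℝ, (∀ x ∈ G.kirchhoffVertices, G.vertexLaplacian f x = g x) ∧
      ∀ x ∈ G.dirichletVertices, f x = 0 := by
  classical
  -- Identity rows at the Dirichlet vertices encode the boundary condition and keep the system
  -- square, so that injectivity implies surjectivity.
  let L : (V → ℝ) →ₗ[ℝ] V → ℝ := LinearMap.pi fun x =>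
    if x ∈ G.dirichletVertices then LinearMap.proj x
    else LinearMap.proj x ∘ₗ G.vertexLaplacian
  have hL1 : ∀ f, ∀ x ∈ G.dirichletVertices, L f x = f x := fun f x hx => by simp [L, hx]
  have hL2 : ∀ f, ∀ x ∈ G.kirchhoffVertices, L f x = G.vertexLaplacian f x := fun f x hx => by
    have hx' : x ∉ G.dirichletVertices := hx
    simp [L, hx']
  have hinj : Function.Injective L := by
    refine (injective_iff_map_eq_zero L).2 fun f hf => ?_
    ext x
    exact eq_zero_of_vertexLaplacian_eq_zero hconn hD
      (fun x hx => by rw [← hL1 f x hx, hf]; rfl) (fun x hx => by rw [← hL2 f x hx, hf]; rfl) x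
  obtain ⟨f, hf⟩ := LinearMap.injective_iff_surjective.1 hinj
    (G.kirchhoffVertices.indicator g)
  refine ⟨f, fun x hx => ?_, fun x hx => ?_⟩
  · rw [← hL2 f x hx, hf, indicator_of_mem hx]
  · rw [← hL1 f x hx, hf, indicator_of_notMem (fun h' : x ∈ G.kirchhoffVertices => h' hx)]

/-- The minimum principle. -/
theorem nonneg_of_vertexLaplacian_nonneg {G : MetricGraph V E} (hconn : G.Connected)
    (hD : G.dirichletVertices.Nonempty) {f : V → ℝ} (h0 : ∀ x ∈ G.dirichletVertices, f x = 0)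
    (h : ∀ x ∈ G.kirchhoffVertices, 0 ≤ G.vertexLaplacian f x) (x : V) : 0 ≤ f x := by
  -- The equation is tested with the negative part `φ` of `f`. On each edge, the increments satisfy
  -- `(δφ)² ≤ -δf δφ`, so the energy of `φ` is at most `-∑ φ L f ≤ 0`.
  have hφ : ∀ x, max (-f x) 0 = 0 := by
    refine eq_zero_of_energy_nonpos hconn hD (fun x hx => by simp [h0 x hx]) ?_
    have h1 : 0 ≤ ∑ x, max (-f x) 0 * G.vertexLaplacian f x := by
      refine Finset.sum_nonneg fun x _ => ?_
      by_cases hx : x ∈ G.dirichletVertices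
      · simp [h0 x hx]
      · exact mul_nonneg (le_max_right _ _) (h x hx)
    rw [sum_mul_vertexLaplacian] at h1
    refine (Finset.sum_le_sum fun e _ => ?_).trans
      ((Finset.sum_neg_distrib _).trans_le (neg_nonpos.2 h1))
    rw [← neg_div]
    refine div_le_div_of_nonneg_right ?_ (G.length_pos e).le
    rcases max_cases (-f (G.src e)) 0 with ⟨h1, h2⟩ | ⟨h1, h2⟩ <;>
      rcases max_cases (-f (G.tgt e)) 0 with ⟨h3, h4⟩ | ⟨h3, h4⟩ <;> rw [h1, h3] <;> nlinarith
  have := hφ x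
  rw [max_eq_right_iff] at this
  linarith

end MetricGraph

/-! ### The weighted graph of a metric graph -/

namespace MetricGraph

variable {V E : Type*} [Fintype E]

open Classical in
-- Without multiple edges, at most one edge contributes to the sum. The function `g` need not vanish
-- at `0`, the value of `lengthBetween` at non-adjacent vertices, hence the explicit case
-- distinction.
theorem ite_adj_lengthBetween (G : MetricGraph V E) (g : ℝ → ℝ) (x y : V) :
    (if G.Adj x y then g (G.lengthBetween x y) else 0) =
      ∑ e, if s(G.src e, G.tgt e) = s(x, y) then g (G.length e) else 0 := by
  by_cases h : G.Adj x y
  · obtain ⟨e, he⟩ := h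
    have huniq : ∀ h : E → ℝ, (∑ e', if s(G.src e', G.tgt e') = s(x, y) then h e' else 0) = h e := by
      intro h
      rw [Finset.sum_eq_single e, if_pos he]
      · intro e' _ hne
        rw [if_neg fun he' => hne (G.simple (he'.trans he.symm))]
      · simp
    rw [if_pos ⟨e, he⟩, huniq, lengthBetween, huniq]
  · rw [if_neg h, Finset.sum_eq_zero]
    intro e _
    rw [if_neg fun he => h ⟨e, he⟩]

variable [Fintype V]

open Classical in
/-- A sum over the neighbours of `x` as a sum over edges. -/
theorem sum_ite_adj_mul (G : MetricGraph V E) (g : ℝ → ℝ) (F : V → ℝ) (x : V) :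
    ∑ y, (if G.Adj x y then g (G.lengthBetween x y) else 0) * F y =
      ∑ e, g (G.length e) * (if G.src e = G.tgt e then (if G.src e = x then F x else 0) else
        (if G.src e = x then F (G.tgt e) else 0) + if G.tgt e = x then F (G.src e) else 0) := by
  simp only [ite_adj_lengthBetween, Finset.sum_mul]
  rw [Finset.sum_comm]
  refine Finset.sum_congr rfl fun e _ => ?_
  simp only [ite_mul, zero_mul, ← mul_ite_zero, ← Finset.mul_sum]
  congr 1
  -- For a fixed edge at `x`, only one `y` survives: the other end of the edge, or `x` itself for a
  -- loop, which is counted once.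
  by_cases hs : G.src e = x
  · by_cases ht : G.tgt e = x
    · rw [Finset.sum_eq_single x] <;> simp [hs, ht]
      exact fun b h1 h2 => absurd h2.symm h1
    · rw [Finset.sum_eq_single (G.tgt e)]
      · simp [hs, ht, Ne.symm ht]
      · intro b _ hb
        rw [if_neg]
        rw [Sym2.eq_iff]
        rintro (⟨-, h⟩ | ⟨-, h⟩)
        exacts [hb h.symm, ht h]
      · simp
  · by_cases ht : G.tgt e = x
    · rw [Finset.sum_eq_single (G.src e)]
      · simp [hs, ht, Sym2.eq_swap]
      · intro b _ hb
        rw [if_neg]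
        rw [Sym2.eq_iff]
        rintro (⟨h, -⟩ | ⟨h, -⟩)
        exacts [hs h, hb h.symm]
      · simp
    · rw [Finset.sum_eq_zero]
      · simp [hs, ht]
      · intro b _
        rw [if_neg]
        rw [Sym2.eq_iff]
        rintro (⟨h, -⟩ | ⟨-, h⟩)
        exacts [hs h, ht h]

/-- The diagonal weight multiplies `f x - f x = 0`, so it may be replaced by `1/(c ℓ)` at a loop and
by `0` elsewhere; then every weight has the same form. -/
theorem sum_discreteWeight_mul_sub (G : MetricGraph V E) (c : ℝ) (f : V → ℝ) (x : V) :
    ∑ y, G.discreteWeight c x y * (f x - f y) = 1 / c * G.vertexLaplacian f x := by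
  classical
  have h : ∀ y, G.discreteWeight c x y * (f x - f y) =
      (if G.Adj x y then (fun l => 1 / (c * l)) (G.lengthBetween x y) else 0) * (f x - f y) := by
    intro y
    rcases eq_or_ne x y with rfl | hxy
    · simp
    · simp only [discreteWeight, if_neg hxy]
  simp only [h]
  rw [sum_ite_adj_mul G (fun l => 1 / (c * l)) (fun y => f x - f y)]
  simp only [vertexLaplacian, LinearMap.coe_mk, AddHom.coe_mk, Finset.mul_sum]
  refine Finset.sum_congr rfl fun e _ => ?_
  by_cases hs : G.src e = x <;> by_cases ht : G.tgt e = x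
  · simp [hs, ht]
  · simp only [hs, ht, Ne.symm ht, if_true, if_false, mul_inv, div_eq_mul_inv]
    ring
  · simp only [hs, ht, if_true, if_false, mul_inv, div_eq_mul_inv]
    ring
  · simp [hs, ht]

/-- In the row sum, `w̃_{xx}` cancels all the terms `1/(c ℓ)` and leaves `∑ c ℓ`; the extra `c
ℓ_{xx}` in the diagonal weight counts the loop a second time. At Dirichlet vertices `w̃_{xx}` is
absent from the weights, hence the restriction on `x`. -/
theorem discreteGraph_vertexWeight (G : MetricGraph V E) {c : ℝ} (hc : G.Admissible c) {x : V}
    (hx : x ∈ G.kirchhoffVertices) :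
    (G.discreteGraph c hc).vertexWeight x = c * G.incidentLength x := by
  classical
  have hA : ∀ y, G.Adj y x ↔ G.Adj x y := fun y => ⟨Adj.symm, Adj.symm⟩
  have h : ∀ y, (G.discreteGraph c hc).weight x y =
      (if G.Adj x y then 1 / (c * G.lengthBetween x y) else 0) +
      if x = y then (if G.Adj x y then c * G.lengthBetween x y else 0) + G.wTilde c x else 0 := by
    intro y
    rcases eq_or_ne x y with rfl | hxy
    · simp only [discreteGraph, discreteWeight, if_true, if_pos hx]
      split_ifs <;> ring
    · simp only [discreteGraph, discreteWeight, if_neg hxy, add_zero]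
  rw [WeightedGraph.vertexWeight, Finset.sum_congr rfl fun y _ => h y, Finset.sum_add_distrib,
    Finset.sum_ite_eq, if_pos (Finset.mem_univ x), wTilde, Finset.sum_filter, Finset.sum_filter]
  simp only [hA, G.lengthBetween_comm _ x]
  have h1 := G.sum_ite_adj_mul (fun l => c * l) (fun _ => 1) x
  have h2 := G.ite_adj_lengthBetween (fun l => c * l) x x
  simp only [mul_one] at h1 h2
  rw [h1, h2, ← add_sub_assoc, add_sub_cancel, ← Finset.sum_add_distrib, incidentLength, Finset.mul_sum]
  refine Finset.sum_congr rfl fun e _ => ?_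
  by_cases hs : G.src e = x <;> by_cases ht : G.tgt e = x
  · simp [hs, ht]
    ring
  · simp [hs, ht, Ne.symm ht]
  · simp [hs, ht]
  · simp [hs, ht]

/-- A stress function of the weighted graph, cut off at the Dirichlet vertices, solves the Poisson
equation of the vertex Laplacian. -/
theorem vertexLaplacian_indicator_of_isStressFunction [MeasurableSpace V]
    [DiscreteMeasurableSpace V] (G : MetricGraph V E) {c : ℝ} (hc : G.Admissible c) {f : V → ℝ}
    (hf : IsStressFunction (G.discreteGraph c hc).randomWalk (G.discreteGraph c hc).measure
      G.kirchhoffVertices f) {x : V} (hx : x ∈ G.kirchhoffVertices) :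
    G.vertexLaplacian (G.kirchhoffVertices.indicator f) x = c ^ 2 * G.incidentLength x := by
  have h := hf.sum_indicator hx
  rw [G.discreteGraph_vertexWeight hc hx] at h
  have h' := (G.sum_discreteWeight_mul_sub c (G.kirchhoffVertices.indicator f) x).symm.trans h
  have := hc.1.ne'
  field_simp at h'
  exact h'

theorem isStressFunction_of_vertexLaplacian [MeasurableSpace V]
    [DiscreteMeasurableSpace V] (G : MetricGraph V E) {c : ℝ} (hc : G.Admissible c) {f : V → ℝ}
    (hf : ∀ x ∈ G.kirchhoffVertices, G.vertexLaplacian f x = c ^ 2 * G.incidentLength x)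
    (h0 : ∀ x ∈ G.dirichletVertices, f x = 0) :
    IsStressFunction (G.discreteGraph c hc).randomWalk (G.discreteGraph c hc).measure
      G.kirchhoffVertices f := by
  refine (WeightedGraph.isStressFunction_iff _ _ f).2
    ⟨fun x hx => ?_, fun x hx => h0 x (not_not.1 hx.1)⟩
  rw [G.discreteGraph_vertexWeight hc hx]
  refine (G.sum_discreteWeight_mul_sub c f x).trans ?_
  have := hc.1.ne'
  rw [hf x hx]
  field_simp

end MetricGraph

/-! ### The torsion function of a metric graph -/

namespace MetricGraph

variable {V E : Type*}

/-- The function with vertex values `a` that solves `-u'' = 1` on every edge. -/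
noncomputable def torsionExtension (G : MetricGraph V E) (a : V → ℝ) (e : E) (t : ℝ) : ℝ :=
  t * (G.length e - t) / 2 + a (G.src e) + (a (G.tgt e) - a (G.src e)) / G.length e * t

theorem hasDerivAt_torsionExtension (G : MetricGraph V E) (a : V → ℝ) (e : E) (t : ℝ) :
    HasDerivAt (G.torsionExtension a e)
      (G.length e / 2 - t + (a (G.tgt e) - a (G.src e)) / G.length e) t := by
  have h := ((((hasDerivAt_id t).mul ((hasDerivAt_id t).const_sub (G.length e))).div_const 2).add_const
    (a (G.src e))).add ((hasDerivAt_id t).const_mul ((a (G.tgt e) - a (G.src e)) / G.length e))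
  refine h.congr_deriv ?_
  simp only [id]
  ring

theorem deriv_torsionExtension (G : MetricGraph V E) (a : V → ℝ) (e : E) :
    deriv (G.torsionExtension a e) =
      fun t => G.length e / 2 - t + (a (G.tgt e) - a (G.src e)) / G.length e :=
  funext fun t => (G.hasDerivAt_torsionExtension a e t).deriv

theorem torsionExtension_zero (G : MetricGraph V E) (a : V → ℝ) (e : E) :
    G.torsionExtension a e 0 = a (G.src e) := by
  simp [torsionExtension]

theorem torsionExtension_length (G : MetricGraph V E) (a : V → ℝ) (e : E) :
    G.torsionExtension a e (G.length e) = a (G.tgt e) := by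
  have := (G.length_pos e).ne'
  simp only [torsionExtension]
  field_simp
  ring

theorem torsionExtension_nonneg (G : MetricGraph V E) {a : V → ℝ} (ha : ∀ x, 0 ≤ a x) (e : E)
    {t : ℝ} (ht : t ∈ Icc 0 (G.length e)) : 0 ≤ G.torsionExtension a e t := by
  have hl := G.length_pos e
  -- The affine part is a convex combination of the two end values.
  have h : G.torsionExtension a e t = t * (G.length e - t) / 2 +
      (a (G.src e) * (G.length e - t) + a (G.tgt e) * t) / G.length e := by
    simp only [torsionExtension]
    field_simp
    ring
  have h1 := ht.1
  have h2 := sub_nonneg.2 ht.2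
  have h3 := ha (G.src e)
  have h4 := ha (G.tgt e)
  rw [h]
  positivity

theorem integral_torsionExtension_edge (G : MetricGraph V E) (a : V → ℝ) (e : E) :
    ∫ t in (0 : ℝ)..G.length e, G.torsionExtension a e t =
      G.length e ^ 3 / 12 + G.length e * (a (G.src e) + a (G.tgt e)) / 2 := by
  have hl := (G.length_pos e).ne'
  have h : ∀ t, HasDerivAt (fun t : ℝ => G.length e / 4 * t ^ 2 - t ^ 3 / 6 + a (G.src e) * t +
      (a (G.tgt e) - a (G.src e)) / G.length e / 2 * t ^ 2) (G.torsionExtension a e t) t := by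
    intro t
    have h := ((((hasDerivAt_pow 2 t).const_mul (G.length e / 4)).sub
      ((hasDerivAt_pow 3 t).div_const 6)).add ((hasDerivAt_id t).const_mul (a (G.src e)))).add
      ((hasDerivAt_pow 2 t).const_mul ((a (G.tgt e) - a (G.src e)) / G.length e / 2))
    refine h.congr_deriv ?_
    simp only [torsionExtension]
    norm_num
    ring
  have hcont : Continuous (G.torsionExtension a e) :=
    continuous_iff_continuousAt.2 fun t => (G.hasDerivAt_torsionExtension a e t).continuousAt
  rw [intervalIntegral.integral_eq_sub_of_hasDerivAt (fun t _ => h t)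
    (hcont.intervalIntegrable _ _)]
  field_simp
  ring

theorem torsionExtension_memFormDomain (G : MetricGraph V E) {a : V → ℝ}
    (ha : ∀ x ∈ G.dirichletVertices, a x = 0) : G.MemFormDomain (G.torsionExtension a) where
  absolutelyContinuous e := by
    refine ContDiffOn.absolutelyContinuousOnInterval (ContDiff.contDiffOn ?_)
    unfold torsionExtension
    fun_prop
  memLp_deriv e := by
    rw [deriv_torsionExtension]
    refine MemLp.of_bound (Continuous.aestronglyMeasurable (by fun_prop))
      (G.length e + |(a (G.tgt e) - a (G.src e)) / G.length e|) ?_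
    refine (ae_restrict_iff' measurableSet_Ioo).2 (.of_forall fun t ht => ?_)
    refine (norm_add_le _ _).trans (add_le_add_left ?_ _)
    rw [Real.norm_eq_abs, abs_le]
    constructor <;> linarith [ht.1, ht.2, G.length_pos e]
  vertex := ⟨a, fun e => ⟨G.torsionExtension_zero a e, G.torsionExtension_length a e⟩, ha⟩

/-- `deriv` takes the value `0` where the function is not differentiable, so it respects differences
only where both functions are differentiable; absolute continuity makes that almost everywhere. -/
theorem MemFormDomain.sub {G : MetricGraph V E} {u φ : E → ℝ → ℝ} (hu : G.MemFormDomain u)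
    (hφ : G.MemFormDomain φ) :
    G.MemFormDomain (fun e => u e - φ e) ∧
      ∀ e, deriv (u e - φ e) =ᵐ[volume.restrict (Ioo 0 (G.length e))]
        deriv (u e) - deriv (φ e) := by
  have hder : ∀ e, deriv (u e - φ e) =ᵐ[volume.restrict (Ioo 0 (G.length e))]
      deriv (u e) - deriv (φ e) := by
    intro e
    refine (ae_restrict_iff' measurableSet_Ioo).2 ?_
    filter_upwards [(hu.absolutelyContinuous e).ae_differentiableAt,
      (hφ.absolutelyContinuous e).ae_differentiableAt] with t h1 h2 ht
    have ht' : t ∈ uIcc 0 (G.length e) := by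
      rw [uIcc_of_le (G.length_pos e).le]
      exact Ioo_subset_Icc_self ht
    exact deriv_sub (h1 ht') (h2 ht')
  obtain ⟨a, ha, ha0⟩ := hu.vertex
  obtain ⟨b, hb, hb0⟩ := hφ.vertex
  refine ⟨⟨fun e => (hu.absolutelyContinuous e).sub (hφ.absolutelyContinuous e),
    fun e => (((hu.memLp_deriv e).sub (hφ.memLp_deriv e)).ae_eq (hder e).symm), a - b,
    fun e => ?_, fun x hx => by simp [ha0 x hx, hb0 x hx]⟩, hder⟩
  simp [(ha e).1, (ha e).2, (hb e).1, (hb e).2]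

variable [Fintype E]

theorem integral_torsionExtension [Fintype V] (G : MetricGraph V E) (a : V → ℝ) :
    G.integral (G.torsionExtension a) =
      1 / 12 * ∑ e, G.length e ^ 3 + 1 / 2 * ∑ x, a x * G.incidentLength x := by
  rw [sum_mul_incidentLength, integral, Finset.mul_sum, Finset.mul_sum, ← Finset.sum_add_distrib]
  refine Finset.sum_congr rfl fun e _ => ?_
  rw [integral_torsionExtension_edge]
  ring

/-- Green's formula for functions with `-u'' = 1` on the edges. -/
theorem form_torsionExtension [Fintype V] (G : MetricGraph V E) (a : V → ℝ) {φ : E → ℝ → ℝ}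
    {b : V → ℝ} (hφ : ∀ e, AbsolutelyContinuousOnInterval (φ e) 0 (G.length e))
    (hb : ∀ e, φ e 0 = b (G.src e) ∧ φ e (G.length e) = b (G.tgt e)) :
    G.form (G.torsionExtension a) φ = G.integral φ +
      ∑ x, b x * (G.vertexLaplacian a x - G.incidentLength x / 2) := by
  have h : ∑ x, b x * (G.vertexLaplacian a x - G.incidentLength x / 2) =
      ∑ x, b x * G.vertexLaplacian a x - (∑ x, b x * G.incidentLength x) / 2 := by
    rw [Finset.sum_div, ← Finset.sum_sub_distrib]
    exact Finset.sum_congr rfl fun x _ => by ring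
  rw [h, sum_mul_vertexLaplacian, sum_mul_incidentLength, Finset.sum_div,
    ← Finset.sum_sub_distrib, form, integral, integral, ← Finset.sum_add_distrib]
  refine Finset.sum_congr rfl fun e _ => ?_
  have hl := (G.length_pos e).ne'
  rw [deriv_torsionExtension]
  have hp : ∀ t, HasDerivAt (fun t => G.length e / 2 - t +
      (a (G.tgt e) - a (G.src e)) / G.length e) (-1) t := fun t =>
    ((hasDerivAt_id t).const_sub _).add_const _
  have hac : AbsolutelyContinuousOnInterval (fun t => G.length e / 2 - t +
      (a (G.tgt e) - a (G.src e)) / G.length e) 0 (G.length e) :=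
    ContDiffOn.absolutelyContinuousOnInterval (ContDiff.contDiffOn (by fun_prop))
  -- The derivative of the extension is the slope of its affine part plus `ℓ/2` at `0` and `-ℓ/2` at
  -- `ℓ`. In the boundary terms the slope gives the Laplacian and `±ℓ/2` gives `-I/2`; the interior
  -- term is `∫ φ`.
  rw [hac.integral_mul_deriv_eq_deriv_mul (hφ e), (hb e).1, (hb e).2]
  simp only [(hp _).deriv, neg_one_mul, intervalIntegral.integral_neg]
  field_simp
  ring

theorem isTorsionFunction_torsionExtension [Fintype V] (G : MetricGraph V E) {a : V → ℝ}
    (h0 : ∀ x ∈ G.dirichletVertices, a x = 0)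
    (ha : ∀ x ∈ G.kirchhoffVertices, G.vertexLaplacian a x = G.incidentLength x / 2) :
    G.IsTorsionFunction (G.torsionExtension a) where
  mem := G.torsionExtension_memFormDomain h0
  memLp e := memLp_const _
  eq φ hφ := by
    obtain ⟨b, hb, hb0⟩ := hφ.vertex
    rw [G.form_torsionExtension a hφ.absolutelyContinuous hb, Finset.sum_eq_zero, add_zero]
    · simp only [integral, neg_one_mul, intervalIntegral.integral_neg, Finset.sum_neg_distrib]
    · intro x _
      by_cases hx : x ∈ G.dirichletVertices
      · rw [hb0 x hx, zero_mul]
      · rw [ha x hx, sub_self, mul_zero]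

/-- An element of the form domain with vanishing form vanishes. -/
theorem MemFormDomain.eqOn_zero_of_form_self {G : MetricGraph V E} (hconn : G.Connected)
    (hD : G.dirichletVertices.Nonempty) {u : E → ℝ → ℝ} (hu : G.MemFormDomain u)
    (h : G.form u u = 0) (e : E) : EqOn (u e) 0 (Icc 0 (G.length e)) := by
  have hconst : ∀ e, ∃ C, ∀ t ∈ uIcc 0 (G.length e), u e t = C := by
    intro e
    have hnn : ∀ e ∈ Finset.univ,
        0 ≤ ∫ t in (0 : ℝ)..G.length e, deriv (u e) t * deriv (u e) t := fun e _ =>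
      intervalIntegral.integral_nonneg (G.length_pos e).le fun t _ => mul_self_nonneg _
    have hz := (Finset.sum_eq_zero_iff_of_nonneg hnn).1 h e (Finset.mem_univ e)
    rw [intervalIntegral.integral_of_le (G.length_pos e).le, integral_Ioc_eq_integral_Ioo,
      integral_eq_zero_iff_of_nonneg (fun t => mul_self_nonneg _)
        ((hu.memLp_deriv e).integrable_mul (hu.memLp_deriv e)), Filter.EventuallyEq,
      Measure.restrict_congr_set Ioo_ae_eq_Icc, ae_restrict_iff' measurableSet_Icc] at hz
    -- The derivative vanishes only almost everywhere, so absolute continuity is essential for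
    -- constancy.
    refine (hu.absolutelyContinuous e).const_of_ae_hasDerivAt_zero ?_
    filter_upwards [hz, (hu.absolutelyContinuous e).ae_differentiableAt] with t h1 h2 ht
    have h3 := h1 (by rwa [uIcc_of_le (G.length_pos e).le] at ht)
    have h4 := (h2 ht).hasDerivAt
    rwa [mul_self_eq_zero.1 h3] at h4
  obtain ⟨b, hb, hb0⟩ := hu.vertex
  have hzero := eq_zero_of_src_eq_tgt hconn hD hb0 fun e => by
    obtain ⟨C, hC⟩ := hconst e
    rw [← (hb e).1, ← (hb e).2, hC _ left_mem_uIcc, hC _ right_mem_uIcc]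
  intro t ht
  obtain ⟨C, hC⟩ := hconst e
  rw [hC t (by rwa [uIcc_of_le (G.length_pos e).le]), ← hC 0 left_mem_uIcc, (hb e).1, hzero]
  rfl

theorem form_sub_left {G : MetricGraph V E} {u φ ψ : E → ℝ → ℝ} (hu : G.MemFormDomain u)
    (hφ : G.MemFormDomain φ) (hψ : G.MemFormDomain ψ) :
    G.form (fun e => u e - φ e) ψ = G.form u ψ - G.form φ ψ := by
  rw [form, form, form, integral, integral, integral, ← Finset.sum_sub_distrib]
  refine Finset.sum_congr rfl fun e _ => ?_
  simp only [intervalIntegral.integral_of_le (G.length_pos e).le, integral_Ioc_eq_integral_Ioo]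
  refine Eq.trans (integral_congr_ae ?_) (integral_sub
    ((hu.memLp_deriv e).integrable_mul (hψ.memLp_deriv e))
    ((hφ.memLp_deriv e).integrable_mul (hψ.memLp_deriv e)))
  filter_upwards [(hu.sub hφ).2 e] with t ht
  rw [ht, Pi.sub_apply, sub_mul]

/-- The difference of two torsion functions is an admissible test function, and testing both
equations with it shows that its form vanishes. -/
theorem IsTorsionFunction.eqOn {G : MetricGraph V E} (hconn : G.Connected)
    (hD : G.dirichletVertices.Nonempty) {u v : E → ℝ → ℝ} (hu : G.IsTorsionFunction u)
    (hv : G.IsTorsionFunction v) (e : E) : EqOn (u e) (v e) (Icc 0 (G.length e)) := by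
  have hw := (hu.mem.sub hv.mem).1
  have h : G.form (fun e => u e - v e) (fun e => u e - v e) = 0 := by
    rw [form_sub_left hu.mem hv.mem hw, sub_eq_zero, ← neg_inj, hu.eq _ hw, hv.eq _ hw]
  intro t ht
  exact sub_eq_zero.1 (hw.eqOn_zero_of_form_self hconn hD h e ht)

/-- The torsion function chosen in the definition agrees with `v` on the closed edges, which is all
that the integral sees. -/
theorem quantumTorsionalRigidity_eq {G : MetricGraph V E} (hconn : G.Connected)
    (hD : G.dirichletVertices.Nonempty) {v : E → ℝ → ℝ} (hv : G.IsTorsionFunction v)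
    (h0 : ∀ e, ∀ t ∈ Icc 0 (G.length e), 0 ≤ v e t) :
    G.quantumTorsionalRigidity = G.integral v := by
  have hex : ∃ v, G.IsTorsionFunction v := ⟨v, hv⟩
  rw [quantumTorsionalRigidity, dif_pos hex, integral, integral]
  refine Finset.sum_congr rfl fun e _ => intervalIntegral.integral_congr fun t ht => ?_
  rw [uIcc_of_le (G.length_pos e).le] at ht
  have := IsTorsionFunction.eqOn hconn hD hex.choose_spec hv e ht
  simp only [this, abs_of_nonneg (h0 e t ht)]

end MetricGraph

/-! ### Comparison of the quantum and the discrete torsional rigidity -/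

theorem mainTheorem12 {V E : Type*} [Fintype V] [Fintype E]
    [MeasurableSpace V] [DiscreteMeasurableSpace V]
    (G : MetricGraph V E) (hconn : G.Connected) (hD : G.dirichletVertices.Nonempty)
    (c : ℝ) (hc : G.Admissible c) :
    ((∃ v, G.IsTorsionFunction v) ∧
      ∀ v₁ v₂, G.IsTorsionFunction v₁ → G.IsTorsionFunction v₂ →
        ∀ e, Set.EqOn (v₁ e) (v₂ e) (Set.Icc 0 (G.length e))) ∧
    ((∃ f, IsStressFunction (G.discreteGraph c hc).randomWalk (G.discreteGraph c hc).measure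
        G.kirchhoffVertices f) ∧
      ∀ f₁ f₂,
        IsStressFunction (G.discreteGraph c hc).randomWalk (G.discreteGraph c hc).measure
          G.kirchhoffVertices f₁ →
        IsStressFunction (G.discreteGraph c hc).randomWalk (G.discreteGraph c hc).measure
          G.kirchhoffVertices f₂ →
        Set.EqOn f₁ f₂ (mClosure (G.discreteGraph c hc).randomWalk G.kirchhoffVertices)) ∧
    G.quantumTorsionalRigidity =
      1 / 12 * ∑ e, G.length e ^ 3 +
        1 / 4 * (1 / c ^ 3) *
          torsionalRigidity (G.discreteGraph c hc).randomWalk (G.discreteGraph c hc).measure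
            G.kirchhoffVertices := by
  obtain ⟨a, ha, ha0⟩ := MetricGraph.exists_vertexLaplacian_eq hconn hD
    fun x => G.incidentLength x / 2
  have hv := G.isTorsionFunction_torsionExtension ha0 ha
  have ha_nonneg : ∀ x, 0 ≤ a x := MetricGraph.nonneg_of_vertexLaplacian_nonneg hconn hD ha0
    fun x hx => by
      rw [ha x hx]
      exact div_nonneg (G.incidentLength_nonneg x) two_pos.le
  -- The factor `2c²` is the ratio of the right-hand sides `c² I` (stress) and `I/2` (torsion).
  have hlap : ∀ x ∈ G.kirchhoffVertices,
      G.vertexLaplacian ((2 * c ^ 2) • a) x = c ^ 2 * G.incidentLength x := fun x hx => by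
    rw [map_smul, Pi.smul_apply, ha x hx, smul_eq_mul]
    ring
  have hlap0 : ∀ x ∈ G.dirichletVertices, ((2 * c ^ 2) • a) x = 0 := fun x hx => by simp [ha0 x hx]
  have hex := G.isStressFunction_of_vertexLaplacian hc hlap hlap0
  have hstress : ∀ f, IsStressFunction (G.discreteGraph c hc).randomWalk
      (G.discreteGraph c hc).measure G.kirchhoffVertices f →
      G.kirchhoffVertices.indicator f = (2 * c ^ 2) • a := fun f hf =>
    MetricGraph.eq_of_vertexLaplacian_eq hconn hD
      (fun x hx => indicator_of_notMem (fun h : x ∈ G.kirchhoffVertices => h hx) f) hlap0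
      fun x hx => by rw [G.vertexLaplacian_indicator_of_isStressFunction hc hf hx, hlap x hx]
  refine ⟨⟨⟨_, hv⟩, fun v₁ v₂ h₁ h₂ => h₁.eqOn hconn hD h₂⟩, ⟨⟨_, hex⟩, fun f₁ f₂ h₁ h₂ x hx => ?_⟩,
    ?_⟩
  · rcases hx with hx | hx
    · rw [← indicator_of_mem hx f₁, ← indicator_of_mem hx f₂, hstress f₁ h₁, hstress f₂ h₂]
    · rw [h₁.boundary x hx, h₂.boundary x hx]
  · have hex' := Exists.intro _ hex
    rw [MetricGraph.quantumTorsionalRigidity_eq hconn hD hv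
      fun e t ht => G.torsionExtension_nonneg ha_nonneg e ht, G.integral_torsionExtension,
      torsionalRigidity, dif_pos hex', WeightedGraph.setIntegral_measure,
      hstress _ hex'.choose_spec]
    congr 1
    rw [Finset.mul_sum, Finset.mul_sum]
    refine Finset.sum_congr rfl fun x _ => ?_
    -- Vertex by vertex, `½ a I = (1/(4c³)) (2c² a) (c I)`. The formula `d_x = c I x` is available
    -- only on `V_N`; on `V_D` both sides vanish with `a`.
    by_cases hx : x ∈ G.dirichletVertices
    · simp [ha0 x hx]
    · have := hc.1.ne'
      rw [G.discreteGraph_vertexWeight hc hx, Pi.smul_apply, smul_eq_mul]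
      field_simp
      ring
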